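/- Let $G$ be a compact connected (smooth, finite-dimensional, real) Lie group with Lie algebra $\mathfrak g$ of left-invariant vector fields and adjoint representation $\mathrm{Ad}\colon G\to \mathrm{GL}(\mathfrak g)$, and write $\mathrm{ad}(X)Y=[X,Y]$ for $X,Y\in\mathfrak g$. Let $X_1,\dots,X_m\in\mathfrak g$, and let $(x_r,u_1^r,\dots,u_m^r)$ be a periodic trajectory of $x'=\sum_{k=1}^m u_kX_k(x)$: the controls $u_k^r\colon\mathbb R\to\mathbb R$ are $C^\infty$, the curve $x_r\colon\mathbb R\to G$ satisfies $x_r'(t)=\sum_{k} u_k^r(t)X_k(x_r(t))$ for all $t\in\mathbb R$, and $x_r,u_1^r,\dots,u_m^r$ are all $T$-periodic for some $T>0$. Assume that the trajectory is regular, i.e. $$\mathrm{span}\{\mathrm{Ad}(x_r(t))X_k \;;\; t\in\mathbb R,\ 1\le k\le m\}=\mathfrak g.$$ Define $V\colon G\to\mathbb R$ by $V(x)=\mathrm{tr}\,\mathrm{Ad}(x)$, and the auxiliary time-dependent vector field $W$ on $G$ by $$W(t,w)=\sum_{k=1}^m a_k(t,w)\,\bigl(\mathrm{Ad}(x_r(t))X_k\bigr)(w),\qquad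 a_k(t,w)=\mathrm dV\bigl((\mathrm{Ad}(x_r(t))X_k)(w)\bigr).$$ Call $w\in G$ an $\omega$-limit point of $W$ if there are an integral curve $\gamma\colon\mathbb R\to G$ of $W$ (that is, $\gamma'(t)=W(t,\gamma(t))$ for all $t$) and an increasing sequence $t_n\to\infty$ with $\gamma(t_n)\to w$, and let $\mathcal C_W=\{w\in G\;;\;W(t,w)=0\ \ \forall t\in\mathbb R\}$ be the set of critical points of $W$. If $w\in G$ is any $\omega$-limit point of $W$, then $$\mathrm{tr}\{\mathrm{Ad}(w)\cdot\mathrm{ad}(X)\}=0\quad\text{for all }X\in\mathfrak g,$$ and equivalently $\mathrm dV\,X(w)=0$ for all $X\in\mathfrak g$, i.e. $w$ is a critical point of $V$. Moreover $$\mathcal C_W=\{w\in G\;;\;\mathrm{tr}\{\mathrm{Ad}(w)\cdot\mathrm{ad}(X)\}=0\ \ \forall X\in\mathfrak g\},$$ and this set coincides both with the set of all $\omega$-limit points of $W$ and with the set of critical points of $V$. -/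

import Mathlib

open scoped Manifold ContDiff Topology

noncomputable section

namespace LieTracking

/-- A curve `γ : ℝ → M` is an integral curve of the time-dependent vector field `F`
if `γ'(t) = F (t, γ t)` for all real `t`. -/
def IsIntegralCurve {E : Type*} [NormedAddCommGroup E] [NormedSpace ℝ E]
    {M : Type*} [TopologicalSpace M] [ChartedSpace E M]
    (F : ℝ → (x : M) → TangentSpace 𝓘(ℝ, E) x) (γ : ℝ → M) : Prop :=
  ∀ t : ℝ, HasMFDerivAt 𝓘(ℝ, ℝ) 𝓘(ℝ, E) γ t ((1 : ℝ →L[ℝ] ℝ).smulRight (F t (γ t)))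

/-- The `ω`-limit set of the time-dependent vector field `F` at `(t₀, x₀)`: the limits of `γ (tₙ)`
along increasing sequences `tₙ → ∞`, for the integral curve `γ` of `F` with `γ t₀ = x₀`. -/
def omegaLimitSet {E : Type*} [NormedAddCommGroup E] [NormedSpace ℝ E]
    {M : Type*} [TopologicalSpace M] [ChartedSpace E M]
    (F : ℝ → (x : M) → TangentSpace 𝓘(ℝ, E) x) (t₀ : ℝ) (x₀ : M) : Set M :=
  {x | ∃ γ : ℝ → M, IsIntegralCurve F γ ∧ γ t₀ = x₀ ∧
    ∃ s : ℕ → ℝ, StrictMono s ∧ Filter.Tendsto s Filter.atTop Filter.atTop ∧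
      Filter.Tendsto (fun n ↦ γ (s n)) Filter.atTop (𝓝 x)}

/-- The set of all `ω`-limit points of `F`, for arbitrary initial data. -/
def omegaLimitPoints {E : Type*} [NormedAddCommGroup E] [NormedSpace ℝ E]
    {M : Type*} [TopologicalSpace M] [ChartedSpace E M]
    (F : ℝ → (x : M) → TangentSpace 𝓘(ℝ, E) x) : Set M :=
  ⋃ (t₀ : ℝ) (x₀ : M), omegaLimitSet F t₀ x₀

/-- The critical points of `F`: the points where `F (t, ·)` vanishes for all times `t`. -/
def criticalPoints {E : Type*} [NormedAddCommGroup E] [NormedSpace ℝ E]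
    {M : Type*} [TopologicalSpace M] [ChartedSpace E M]
    (F : ℝ → (x : M) → TangentSpace 𝓘(ℝ, E) x) : Set M :=
  {x | ∀ t : ℝ, F t x = 0}

section Group

variable {E : Type*} [NormedAddCommGroup E] [NormedSpace ℝ E]
  {G : Type*} [TopologicalSpace G] [ChartedSpace E G] [Group G]

variable (E) in
/-- The adjoint map `Ad E x : 𝔤 → 𝔤`, the differential at the identity of `y ↦ x * y * x⁻¹`. -/
def Ad (x : G) : GroupLieAlgebra 𝓘(ℝ, E) G →L[ℝ] GroupLieAlgebra 𝓘(ℝ, E) G :=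
  mfderiv 𝓘(ℝ, E) 𝓘(ℝ, E) (fun y : G ↦ x * y * x⁻¹) (1 : G)

variable (E) in
/-- The Lyapunov-like function `V x = tr (Ad x)`. -/
def V (x : G) : ℝ :=
  LinearMap.trace ℝ (GroupLieAlgebra 𝓘(ℝ, E) G)
    (Ad E x : GroupLieAlgebra 𝓘(ℝ, E) G →ₗ[ℝ] GroupLieAlgebra 𝓘(ℝ, E) G)

/-- The differential of `V` at `x`. -/
def dV (x : G) : TangentSpace 𝓘(ℝ, E) x →L[ℝ] ℝ :=
  mfderiv 𝓘(ℝ, E) 𝓘(ℝ, ℝ) (V E : G → ℝ) x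

variable {m : ℕ} (X : Fin m → GroupLieAlgebra 𝓘(ℝ, E) G)

/-- A smooth trajectory `(x, u₁, …, uₘ)` of the left-invariant driftless system
`x' = ∑ₖ uₖ Xₖ(x)`. -/
structure IsTrajectory (x : ℝ → G) (u : Fin m → ℝ → ℝ) : Prop where
  contDiff_control : ∀ k, ContDiff ℝ ∞ (u k)
  isIntegralCurve :
    IsIntegralCurve (fun t g ↦ ∑ k, u k t • mulInvariantVectorField (X k) g) x

/-- A `T`-periodic smooth trajectory, `T > 0`. -/
structure IsPeriodicTrajectory (T : ℝ) (x : ℝ → G) (u : Fin m → ℝ → ℝ) : Prop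
    extends IsTrajectory X x u where
  period_pos : 0 < T
  periodic_curve : Function.Periodic x T
  periodic_control : ∀ k, Function.Periodic (u k) T

/-- Regularity of a trajectory: the vectors `Ad (x t) Xₖ` span the Lie algebra. -/
def IsRegular (x : ℝ → G) : Prop :=
  Submodule.span ℝ {Y : GroupLieAlgebra 𝓘(ℝ, E) G | ∃ (t : ℝ) (k : Fin m), Y = Ad E (x t) (X k)} = ⊤

/-- The coefficients `aₖ(t, w) = dV (Ad (xᵣ t) Xₖ (w))`. -/
def auxCoeff (xr : ℝ → G) (k : Fin m) (t : ℝ) (w : G) : ℝ :=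
  dV w (mulInvariantVectorField (Ad E (xr t) (X k)) w)

/-- The auxiliary vector field `W(t, w) = ∑ₖ aₖ(t, w) Ad (xᵣ t) Xₖ (w)`. -/
def auxField (xr : ℝ → G) (t : ℝ) (w : G) : TangentSpace 𝓘(ℝ, E) w :=
  ∑ k, auxCoeff X xr k t w • mulInvariantVectorField (Ad E (xr t) (X k)) w

/-- A smooth Lie group has the regularity for which Mathlib defines the Lie bracket. -/
instance instLieGroupMinSmoothness [LieGroup 𝓘(ℝ, E) ∞ G] :
    LieGroup 𝓘(ℝ, E) (minSmoothness ℝ 3) G :=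
  LieGroup.of_le (n := ∞) (by
    rw [minSmoothness_of_isRCLikeNormedField]
    exact WithTop.coe_le_coe.2 (le_top : (3 : ℕ∞) ≤ ⊤))

/-- The trace of `Ad w ∘ ad Y`, where `ad Y Z = ⁅Y, Z⁆`. -/
def trAdad [FiniteDimensional ℝ E] [LieGroup 𝓘(ℝ, E) ∞ G] (w : G) (Y : GroupLieAlgebra 𝓘(ℝ, E) G) : ℝ :=
  haveI : CompleteSpace E := FiniteDimensional.complete ℝ E
  LinearMap.trace ℝ (GroupLieAlgebra 𝓘(ℝ, E) G)
    ((Ad E w : GroupLieAlgebra 𝓘(ℝ, E) G →ₗ[ℝ] GroupLieAlgebra 𝓘(ℝ, E) G) ∘ₗ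
      (LieAlgebra.ad ℝ (GroupLieAlgebra 𝓘(ℝ, E) G) Y))

end Group

end LieTracking

end

/-!
Write `A = Ad ∘ γ` along an integral curve `γ` of `W` and `zₖ(t) = Ad (xᵣ t) Xₖ`. Since `d(Ad)` maps
the left-invariant field of `Y` at `w` to `Ad w ∘ ad Y`, we have `dV (Y(w)) = tr (Ad w ∘ ad Y)`, and
`A` solves a `T`-periodic equation `A' = f (A, z)` in `End 𝔤`, along which `tr A = V ∘ γ` increases
at rate `q (A, z) = ∑ₖ aₖ²`. As `Ad` is bounded, Barbalat's lemma gives `q (A, z) → 0`, and `f`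
vanishes wherever `q` does, so `A' → 0`. Thus `A` is asymptotically constant over a period, and a
limit `Ad w` of `A` satisfies `q (Ad w, z(t)) = 0` for every `t`, that is, all `aₖ(t, w)` vanish. By
regularity the vectors `zₖ(t)` span `𝔤`, hence `dV` vanishes at `w`. Conversely a critical point of
`W` is the limit of a constant integral curve.

That the differential of `Ad` at the identity is the bracket of left-invariant vector fields is
computed in a chart: with `P` the local multiplication and `e` the identity, `Ad` is characterised
by `∂₁P(e, u) (Ad u Z) = ∂₂P(u, e) Z`, and differentiating in `u` at `e` gives the difference of
mixed second derivatives of `P` that is the bracket.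
-/

namespace LieTracking

open Filter Function Set

section InvariancePrinciple

/-- Barbalat's lemma. -/
theorem tendsto_deriv_zero_of_tendsto_of_uniformContinuous {F : Type*} [NormedAddCommGroup F]
    [NormedSpace ℝ F] {v v' : ℝ → F} {l : F} (hv : ∀ t, HasDerivAt v (v' t) t)
    (hlim : Tendsto v atTop (𝓝 l)) (huc : UniformContinuous v') :
    Tendsto v' atTop (𝓝 0) := by
  rw [Metric.tendsto_atTop]
  intro ε hε
  obtain ⟨δ, hδ, hv'⟩ := Metric.uniformContinuous_iff.1 huc (ε / 2) (half_pos hε)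
  obtain ⟨h, hh, hhδ⟩ := exists_between hδ
  have hincr : Tendsto (fun t ↦ v (t + h) - v t) atTop (𝓝 0) := by
    simpa using (hlim.comp (tendsto_atTop_add_const_right _ h tendsto_id)).sub hlim
  obtain ⟨N, hN⟩ := Metric.tendsto_atTop.1 hincr (h * (ε / 2)) (by positivity)
  refine ⟨N, fun t ht ↦ ?_⟩
  have htaylor : ‖v (t + h) - v t - h • v' t‖ ≤ ε / 2 * h := by
    have := (convex_Icc t (t + h)).norm_image_sub_le_of_norm_hasDerivWithin_le
      (f := fun s ↦ v s - s • v' t) (f' := fun s ↦ v' s - v' t) (C := ε / 2)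
      (fun s _ ↦ by
        simpa using! ((hv s).fun_sub ((hasDerivAt_id s).smul_const (v' t))).hasDerivWithinAt)
      (fun s hs ↦ by
        rw [← dist_eq_norm]
        refine (hv' ?_).le
        rw [Real.dist_eq, abs_lt]
        constructor <;> linarith [hs.1, hs.2])
      (left_mem_Icc.2 (by linarith)) (right_mem_Icc.2 (by linarith))
    rw [add_sub_cancel_left, Real.norm_of_nonneg hh.le] at this
    convert this using 2
    rw [add_smul]
    abel
  have hsmul : h * ‖v' t‖ < h * ε := calc
    h * ‖v' t‖ = ‖(v (t + h) - v t) - (v (t + h) - v t - h • v' t)‖ := by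
      rw [sub_sub_cancel, norm_smul, Real.norm_of_nonneg hh.le]
    _ ≤ ‖v (t + h) - v t‖ + ‖v (t + h) - v t - h • v' t‖ := norm_sub_le _ _
    _ < h * (ε / 2) + ε / 2 * h :=
      add_lt_add_of_lt_of_le (by simpa using hN t ht) htaylor
    _ = h * ε := by ring
  simpa using lt_of_mul_lt_mul_left hsmul hh.le

theorem tendsto_deriv_zero_of_nonneg_of_bddAbove {v v' : ℝ → ℝ}
    (hv : ∀ t, HasDerivAt v (v' t) t) (hnonneg : ∀ t, 0 ≤ v' t) (hbdd : BddAbove (range v))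
    (huc : UniformContinuous v') : Tendsto v' atTop (𝓝 0) :=
  have hmono : Monotone v := monotone_of_hasDerivAt_nonneg hv hnonneg
  tendsto_deriv_zero_of_tendsto_of_uniformContinuous hv (tendsto_atTop_ciSup hmono hbdd) huc

theorem uniformContinuous_of_continuous_of_periodic {P : Type*} [UniformSpace P] {z : ℝ → P}
    {T : ℝ} (hT : 0 < T) (hz : Continuous z) (hzT : Periodic z T) : UniformContinuous z := by
  have : Fact (0 < T) := ⟨hT⟩
  have hlift : UniformContinuous (hzT.lift : AddCircle T → P) :=
    CompactSpace.uniformContinuous_of_continuous (continuous_coinduced_dom.2 hz)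
  have hcoe : UniformContinuous ((↑) : ℝ → AddCircle T) :=
    uniformContinuous_addMonoidHom_of_continuous (f := QuotientAddGroup.mk' _)
      (AddCircle.continuous_mk' T)
  exact hlift.comp hcoe

theorem uniformContinuous_comp_of_isCompact {α β γ : Type*} [UniformSpace α] [UniformSpace β]
    [UniformSpace γ] {g : β → γ} {p : α → β} {K : Set β} (hK : IsCompact K)
    (hg : ContinuousOn g K) (hp : UniformContinuous p) (hpK : ∀ x, p x ∈ K) :
    UniformContinuous (g ∘ p) := by
  have hgK := hK.uniformContinuousOn_of_continuous hg
  rw [← uniformContinuousOn_univ] at hp ⊢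
  exact hgK.comp hp fun x _ ↦ hpK x

theorem tendsto_zero_of_isCompact_of_tendsto_zero {ι β γ : Type*} [TopologicalSpace β]
    [TopologicalSpace γ] [Zero γ] {q : β → ℝ} {f : β → γ} (hq : Continuous q) (hf : Continuous f)
    (hqf : ∀ x, q x = 0 → f x = 0) {K : Set β} (hK : IsCompact K) {p : ι → β} (hpK : ∀ i, p i ∈ K)
    {l : Filter ι} (h : Tendsto (q ∘ p) l (𝓝 0)) : Tendsto (f ∘ p) l (𝓝 0) := by
  rw [tendsto_iff_ultrafilter]
  intro U hU
  obtain ⟨x, -, hx⟩ := hK.ultrafilter_le_nhds (U.map p)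
    (tendsto_principal.2 (.of_forall hpK))
  have hqx : q x = 0 := tendsto_nhds_unique ((hq.tendsto x).comp hx) (h.mono_left hU)
  rw [← hqf x hqx]
  exact (hf.tendsto x).comp hx

theorem tendsto_sub_zero_of_tendsto_deriv_zero {F : Type*} [NormedAddCommGroup F]
    [NormedSpace ℝ F] {A A' : ℝ → F} (hA : ∀ t, HasDerivAt A (A' t) t)
    (hA' : Tendsto A' atTop (𝓝 0)) {ι : Type*} {l : Filter ι} {s r : ι → ℝ} {T : ℝ}
    (hs : Tendsto s l atTop) (hr : ∀ i, r i ∈ Icc (s i) (s i + T)) :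
    Tendsto (fun i ↦ A (r i) - A (s i)) l (𝓝 0) := by
  rw [Metric.tendsto_nhds]
  intro ε hε
  obtain ⟨N, hN⟩ := Metric.tendsto_atTop.1 hA' (ε / (|T| + 1)) (by positivity)
  filter_upwards [hs.eventually_ge_atTop N] with i hi
  have hle : ‖A (r i) - A (s i)‖ ≤ ε / (|T| + 1) * ‖r i - s i‖ :=
    (convex_Ici N).norm_image_sub_le_of_norm_hasDerivWithin_le
      (fun t _ ↦ (hA t).hasDerivWithinAt) (fun t ht ↦ by simpa using (hN t ht).le)
      hi (hi.trans (hr i).1)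
  rw [dist_zero_right]
  calc ‖A (r i) - A (s i)‖ ≤ ε / (|T| + 1) * ‖r i - s i‖ := hle
    _ ≤ ε / (|T| + 1) * |T| := by
      gcongr
      rw [Real.norm_of_nonneg (by linarith [(hr i).1])]
      linarith [(hr i).2, le_abs_self T]
    _ < ε / (|T| + 1) * (|T| + 1) := by gcongr; linarith
    _ = ε := by field_simp

variable {F P : Type*} [NormedAddCommGroup F] [NormedSpace ℝ F] [UniformSpace P]
  {f : F × P → F} {q : F × P → ℝ} {z : ℝ → P} {T : ℝ} {A : ℝ → F} {K : Set F}

theorem uniformContinuous_of_hasDerivAt_periodic (hf : Continuous f) (hT : 0 < T)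
    (hz : Continuous z) (hzT : Periodic z T) (hK : IsCompact K) (hAK : ∀ t, A t ∈ K)
    (hA : ∀ t, HasDerivAt A (f (A t, z t)) t) : UniformContinuous fun t ↦ (A t, z t) := by
  have hcomp : IsCompact (K ×ˢ range z) := hK.prod (hzT.compact_of_continuous hT.ne' hz)
  obtain ⟨C, hC⟩ := hcomp.exists_bound_of_continuousOn hf.continuousOn
  have hAlip : LipschitzWith C.toNNReal A :=
    lipschitzWith_of_nnnorm_deriv_le (fun t ↦ (hA t).differentiableAt) fun t ↦ by
      rw [(hA t).deriv, ← NNReal.coe_le_coe, coe_nnnorm]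
      exact (hC _ ⟨hAK t, t, rfl⟩).trans (Real.le_coe_toNNReal C)
  exact hAlip.uniformContinuous.prodMk (uniformContinuous_of_continuous_of_periodic hT hz hzT)

/-- An invariance principle: since `A' → 0`, moving `s i` forward by at most a period, to a time
congruent to `t` mod `T`, does not change the limit of `A ∘ s`. -/
theorem eq_zero_of_tendsto_of_periodic (hf : Continuous f) (hq : Continuous q)
    (hq0 : ∀ p, 0 ≤ q p) (hqf : ∀ p, q p = 0 → f p = 0) (hT : 0 < T)
    (hz : Continuous z) (hzT : Periodic z T) (hK : IsCompact K) (hAK : ∀ t, A t ∈ K)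
    (hA : ∀ t, HasDerivAt A (f (A t, z t)) t) {v : ℝ → ℝ}
    (hv : ∀ t, HasDerivAt v (q (A t, z t)) t) (hvb : BddAbove (range v))
    {ι : Type*} {l : Filter ι} [l.NeBot] {s : ι → ℝ} (hs : Tendsto s l atTop) {B : F}
    (hB : Tendsto (A ∘ s) l (𝓝 B)) (t : ℝ) : q (B, z t) = 0 := by
  have hcomp : IsCompact (K ×ˢ range z) := hK.prod (hzT.compact_of_continuous hT.ne' hz)
  have hmem : ∀ t, (A t, z t) ∈ K ×ˢ range z := fun t ↦ ⟨hAK t, t, rfl⟩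
  have hqlim : Tendsto (fun t ↦ q (A t, z t)) atTop (𝓝 0) :=
    tendsto_deriv_zero_of_nonneg_of_bddAbove hv (fun t ↦ hq0 _) hvb <|
      uniformContinuous_comp_of_isCompact hcomp hq.continuousOn
        (uniformContinuous_of_hasDerivAt_periodic hf hT hz hzT hK hAK hA) hmem
  have hflim : Tendsto (fun t ↦ f (A t, z t)) atTop (𝓝 0) :=
    tendsto_zero_of_isCompact_of_tendsto_zero hq hf hqf hcomp hmem hqlim
  choose r hr hzr using fun i ↦ hzT.exists_mem_Ico hT t (s i)
  have hBr : Tendsto (A ∘ r) l (𝓝 B) := by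
    simpa using! (tendsto_sub_zero_of_tendsto_deriv_zero hA hflim hs
      fun i ↦ Ico_subset_Icc_self (hr i)).add hB
  have hqr : Tendsto (fun i ↦ q (A (r i), z (r i))) l (𝓝 (q (B, z t))) := by
    simp only [← hzr]
    exact (hq.tendsto _).comp (hBr.prodMk_nhds tendsto_const_nhds)
  exact tendsto_nhds_unique hqr
    (hqlim.comp (tendsto_atTop_mono (fun i ↦ (hr i).1) hs))

end InvariancePrinciple

section LocalMultiplication

variable {𝕜 E E' F : Type*} [NontriviallyNormedField 𝕜] [NormedAddCommGroup E] [NormedSpace 𝕜 E]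
  [NormedAddCommGroup E'] [NormedSpace 𝕜 E'] [NormedAddCommGroup F] [NormedSpace 𝕜 F]

theorem fderiv_prodMk_left {f : E × E' → F} {u : E} {v : E'} (hf : DifferentiableAt 𝕜 f (u, v))
    (Y : E) : fderiv 𝕜 (fun u ↦ f (u, v)) u Y = fderiv 𝕜 f (u, v) (Y, 0) := by
  have h := HasFDerivAt.comp (f := fun u ↦ (u, v)) u hf.hasFDerivAt (hasFDerivAt_prodMk_left u v)
  exact DFunLike.congr_fun h.fderiv Y

theorem fderiv_prodMk_right {f : E × E' → F} {u : E} {v : E'} (hf : DifferentiableAt 𝕜 f (u, v))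
    (Z : E') : fderiv 𝕜 (fun v ↦ f (u, v)) v Z = fderiv 𝕜 f (u, v) (0, Z) := by
  have h := hf.hasFDerivAt.comp v (hasFDerivAt_prodMk_right u v)
  exact DFunLike.congr_fun h.fderiv Z

theorem hasFDerivAt_fderiv_prodMk_left_apply {f : E × E' → F} {u : E} {v : E'}
    (hf : DifferentiableAt 𝕜 (fderiv 𝕜 f) (u, v)) (p : E × E') :
    HasFDerivAt (fun u ↦ fderiv 𝕜 f (u, v) p)
      ((fderiv 𝕜 (fderiv 𝕜 f) (u, v)).flip p ∘L .inl 𝕜 E E') u := by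
  simpa using! HasFDerivAt.comp (f := fun u ↦ (u, v)) u
    (hf.hasFDerivAt.clm_apply (hasFDerivAt_const p (u, v))) (hasFDerivAt_prodMk_left u v)

/-- Differentiate `∂₁P(e, u) (K u Z) = ∂₂P(u, e) Z` in `u` at `e` and use the symmetry of the second
derivative of `P`. -/
theorem fderiv_apply_eq_lieBracket {P : E × E → E} {K : E → E →L[𝕜] E} {e : E}
    (hP : ContDiffAt 𝕜 (minSmoothness 𝕜 2) P (e, e)) (hPl : ∀ᶠ u in 𝓝 e, P (u, e) = u)
    (hPr : ∀ᶠ u in 𝓝 e, P (e, u) = u) (hK : DifferentiableAt 𝕜 K e)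
    (hPK : ∀ᶠ u in 𝓝 e, ∀ Z, fderiv 𝕜 P (e, u) (K u Z, 0) = fderiv 𝕜 P (u, e) (0, Z)) (Y Z : E) :
    fderiv 𝕜 K e Y Z = VectorField.lieBracket 𝕜 (fun u ↦ fderiv 𝕜 P (u, e) (0, Y))
      (fun u ↦ fderiv 𝕜 P (u, e) (0, Z)) e := by
  have hP2 : ContDiffAt 𝕜 2 P (e, e) := hP.of_le le_minSmoothness
  have hPd : DifferentiableAt 𝕜 P (e, e) := hP2.differentiableAt (by simp)
  have hdP : DifferentiableAt 𝕜 (fderiv 𝕜 P) (e, e) :=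
    (hP2.fderiv_right (m := 1) (by norm_num)).differentiableAt (by simp)
  have hsymm : IsSymmSndFDerivAt 𝕜 P (e, e) := hP.isSymmSndFDerivAt le_rfl
  have hP₁ (W : E) : fderiv 𝕜 P (e, e) (W, 0) = W := by
    rw [← fderiv_prodMk_left hPd, EventuallyEq.fderiv_eq hPl, fderiv_fun_id,
      ContinuousLinearMap.id_apply]
  have hP₂ (W : E) : fderiv 𝕜 P (e, e) (0, W) = W := by
    rw [← fderiv_prodMk_right hPd, EventuallyEq.fderiv_eq hPr, fderiv_fun_id,
      ContinuousLinearMap.id_apply]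
  have hKe : K e Z = Z := by simpa only [hP₁, hP₂] using hPK.self_of_nhds Z
  have hright (W : E) := hasFDerivAt_fderiv_prodMk_left_apply hdP (0, W)
  have hleft := (hdP.hasFDerivAt.comp e (hasFDerivAt_prodMk_right e e)).clm_apply
    ((hK.hasFDerivAt.clm_apply (hasFDerivAt_const Z e)).prodMk (hasFDerivAt_const (0 : E) e))
  have hderiv := DFunLike.congr_fun
    (hleft.unique ((hright Z).congr_of_eventuallyEq (hPK.mono fun u hu ↦ hu Z))) Y
  have hdK : fderiv 𝕜 K e Y Z + fderiv 𝕜 (fderiv 𝕜 P) (e, e) (0, Y) (Z, 0) =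
      fderiv 𝕜 (fderiv 𝕜 P) (e, e) (Y, 0) (0, Z) := by
    simpa [hKe, hP₁] using hderiv
  rw [VectorField.lieBracket, (hright Z).fderiv, (hright Y).fderiv, hP₂, hP₂]
  simpa [hsymm.eq (Z, 0) (0, Y)] using eq_sub_of_add_eq hdK

end LocalMultiplication

section ModelDerivative

variable {𝕜 : Type*} [NontriviallyNormedField 𝕜]
  {E : Type*} [NormedAddCommGroup E] [NormedSpace 𝕜 E]
  {E' : Type*} [NormedAddCommGroup E'] [NormedSpace 𝕜 E']
  {F : Type*} [NormedAddCommGroup F] [NormedSpace 𝕜 F]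
  {M : Type*} [TopologicalSpace M] [ChartedSpace E M]
  {M' : Type*} [TopologicalSpace M'] [ChartedSpace E' M']
  {N : Type*} [TopologicalSpace N] [ChartedSpace F N]

variable (𝕜 E E') in
/-- The manifold derivative of `f` at `x` as a continuous linear map between the model spaces, on
which, unlike on the tangent spaces, there is a norm and the base point is forgotten. -/
noncomputable def modelMFDeriv (f : M → M') (x : M) : E →L[𝕜] E' := mfderiv 𝓘(𝕜, E) 𝓘(𝕜, E') f x

theorem modelMFDeriv_comp {g : M' → N} {f : M → M'} {x : M} {y : M'} (hy : f x = y)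
    (hg : MDifferentiableAt 𝓘(𝕜, E') 𝓘(𝕜, F) g y) (hf : MDifferentiableAt 𝓘(𝕜, E) 𝓘(𝕜, E') f x) :
    modelMFDeriv 𝕜 E F (g ∘ f) x = modelMFDeriv 𝕜 E' F g y ∘L modelMFDeriv 𝕜 E E' f x := by
  subst hy
  exact mfderiv_comp x hg hf

theorem modelMFDeriv_clm_comp (L : E' →L[𝕜] F) {f : M → E'} {x : M}
    (hf : MDifferentiableAt 𝓘(𝕜, E) 𝓘(𝕜, E') f x) :
    modelMFDeriv 𝕜 E F (L ∘ f) x = L ∘L modelMFDeriv 𝕜 E E' f x := by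
  rw [modelMFDeriv_comp rfl L.differentiableAt.mdifferentiableAt hf]
  congr 1
  exact L.mfderiv_eq

theorem modelMFDeriv_eq_fderiv {f : M → F} {x : M}
    (hf : MDifferentiableAt 𝓘(𝕜, E) 𝓘(𝕜, F) f x) :
    modelMFDeriv 𝕜 E F f x =
      fderiv 𝕜 (f ∘ (extChartAt 𝓘(𝕜, E) x).symm) (extChartAt 𝓘(𝕜, E) x x) := by
  rw [← fderivWithin_univ, ← ModelWithCorners.range_eq_univ 𝓘(𝕜, E)]
  exact hf.mfderiv

theorem contMDiffAt_modelMFDeriv [IsManifold 𝓘(𝕜, E) 1 M] [IsManifold 𝓘(𝕜, E') 1 M']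
    [IsManifold 𝓘(𝕜, F) 1 N]
    {f : N → M → M'} {x : N} {y : M} {y' : M'} {m n : ℕ∞ω}
    (hf : ContMDiffAt (𝓘(𝕜, F).prod 𝓘(𝕜, E)) 𝓘(𝕜, E') n (uncurry f) (x, y))
    (hfy : ∀ x, f x y = y') (hmn : m + 1 ≤ n) :
    ContMDiffAt 𝓘(𝕜, F) 𝓘(𝕜, E →L[𝕜] E') m (fun x ↦ modelMFDeriv 𝕜 E E' (f x) y) x := by
  have hcoord (x' : N) : inTangentCoordinates 𝓘(𝕜, E) 𝓘(𝕜, E') (fun _ ↦ y) (fun x ↦ f x y)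
      (fun x ↦ modelMFDeriv 𝕜 E E' (f x) y) x x' = modelMFDeriv 𝕜 E E' (f x') y := by
    rw [inTangentCoordinates_eq _ _ _ (by simp) (by simp [hfy])]
    ext v
    simp only [hfy, ContinuousLinearMap.comp_apply]
    rw [(tangentBundleCore _ _).coordChange_self _ _ (mem_achart_source E y),
      (tangentBundleCore _ _).coordChange_self _ _ (mem_achart_source E' y')]
  exact (hf.mfderiv f (fun _ ↦ y) contMDiffAt_const hmn).congr_of_eventuallyEq
    (.of_forall fun x' ↦ (hcoord x').symm)
end ModelDerivative

section Adjoint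

variable {E : Type*} [NormedAddCommGroup E] [NormedSpace ℝ E]
  {G : Type*} [TopologicalSpace G] [ChartedSpace E G] [Group G]

variable (E) in
/-- The adjoint map `Ad x` as an endomorphism of the model space, which carries the norm that makes
`x ↦ Ad x` a smooth map into a normed space. -/
noncomputable def modelAd (x : G) : E →L[ℝ] E := Ad E x

variable (E G) in
/-- The adjoint representation `ad` of the Lie algebra as a continuous bilinear map on the model
space, taken to be the differential of `Ad` at the identity. -/
noncomputable def adL : E →L[ℝ] E →L[ℝ] E := modelMFDeriv ℝ E (E →L[ℝ] E) (modelAd E) (1 : G)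

variable (E G) in
/-- The bilinear map `(A, Y) ↦ A ∘ ad Y`, which describes the derivative of `Ad` along
left-invariant vector fields. -/
noncomputable def compAd : (E →L[ℝ] E) →L[ℝ] E →L[ℝ] E →L[ℝ] E :=
  ((ContinuousLinearMap.compL ℝ E E E).flip ∘L adL E G).flip

section Conjugation

variable [LieGroup 𝓘(ℝ, E) ∞ G]

theorem mdifferentiableAt_mul_left (x y : G) : MDifferentiableAt 𝓘(ℝ, E) 𝓘(ℝ, E) (x * ·) y :=
  (contMDiff_mul_left (I := 𝓘(ℝ, E)) (n := ∞) (a := x)).mdifferentiableAt (by simp)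

theorem mdifferentiableAt_mul_right (x y : G) : MDifferentiableAt 𝓘(ℝ, E) 𝓘(ℝ, E) (· * x) y :=
  (contMDiff_mul_right (I := 𝓘(ℝ, E)) (n := ∞) (a := x)).mdifferentiableAt (by simp)

theorem mdifferentiableAt_conj (x y : G) :
    MDifferentiableAt 𝓘(ℝ, E) 𝓘(ℝ, E) (fun y ↦ x * y * x⁻¹) y :=
  (mdifferentiableAt_mul_right x⁻¹ (x * y)).comp y (mdifferentiableAt_mul_left x y)

theorem modelAd_mul (x y : G) : modelAd E (x * y) = modelAd E x ∘L modelAd E y := by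
  have hconj : (fun z ↦ x * y * z * (x * y)⁻¹) = (fun z ↦ x * z * x⁻¹) ∘ fun z ↦ y * z * y⁻¹ := by
    ext z
    simp [mul_assoc]
  have h := modelMFDeriv_comp (by simp) (mdifferentiableAt_conj (E := E) x 1)
    (mdifferentiableAt_conj y 1)
  rw [← hconj] at h
  exact h

theorem contMDiff_modelAd : ContMDiff 𝓘(ℝ, E) 𝓘(ℝ, E →L[ℝ] E) ∞ (modelAd E : G → E →L[ℝ] E) :=
  fun _ ↦ contMDiffAt_modelMFDeriv (n := ∞) (f := fun x y : G ↦ x * y * x⁻¹) (y' := 1)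
    ((contMDiff_fst.mul contMDiff_snd).mul contMDiff_fst.inv).contMDiffAt (by simp) (by simp)

theorem modelMFDeriv_modelAd (w : G) (Y : E) :
    modelMFDeriv ℝ E (E →L[ℝ] E) (modelAd E) w
      (mulInvariantVectorField (I := 𝓘(ℝ, E)) (G := G) Y w) = compAd E G (modelAd E w) Y := by
  have hmul : modelAd E ∘ (w * ·) = ContinuousLinearMap.compL ℝ E E E (modelAd E w) ∘ modelAd E :=
    funext fun y ↦ modelAd_mul w y
  have hAd (x : G) : MDifferentiableAt 𝓘(ℝ, E) 𝓘(ℝ, E →L[ℝ] E) (modelAd E) x :=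
    contMDiff_modelAd.mdifferentiableAt (by simp)
  have h := modelMFDeriv_comp (mul_one w) (hAd w) (mdifferentiableAt_mul_left w 1)
  rw [hmul, modelMFDeriv_clm_comp _ (hAd 1)] at h
  exact (DFunLike.congr_fun h Y).symm

theorem hasDerivAt_modelAd_comp {F : ℝ → (x : G) → TangentSpace 𝓘(ℝ, E) x} {γ : ℝ → G}
    (hγ : IsIntegralCurve F γ) {t : ℝ} {Y : E}
    (hY : F t (γ t) = mulInvariantVectorField (I := 𝓘(ℝ, E)) (G := G) Y (γ t)) :
    HasDerivAt (modelAd E ∘ γ) (compAd E G (modelAd E (γ t)) Y) t := by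
  have hAd : MDifferentiableAt 𝓘(ℝ, E) 𝓘(ℝ, E →L[ℝ] E) (modelAd E) (γ t) :=
    contMDiff_modelAd.mdifferentiableAt (by simp)
  have h : HasFDerivAt (modelAd E ∘ γ) (modelMFDeriv ℝ E (E →L[ℝ] E) (modelAd E) (γ t) ∘L
      (1 : ℝ →L[ℝ] ℝ).smulRight (M₂ := E) (F t (γ t))) t :=
    (hAd.hasMFDerivAt.comp t (hγ t)).hasFDerivAt
  rw [← modelMFDeriv_modelAd, ← hY]
  convert! h.hasDerivAt using 1
  exact congrArg (modelMFDeriv ℝ E (E →L[ℝ] E) (modelAd E) (γ t)) (one_smul ℝ (F t (γ t) : E)).symm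

end Conjugation

local notation "φ" => extChartAt 𝓘(ℝ, E) (1 : G)

variable (E G) in
/-- The multiplication of `G` read in the preferred chart at the identity. -/
noncomputable def chartMul (p : E × E) : E := φ ((φ).symm p.1 * (φ).symm p.2)

theorem chartMul_one {u : E} (hu : u ∈ (φ).target) : chartMul E G (u, φ 1) = u := by
  simp only [chartMul, extChartAt_to_inv, mul_one, (φ).right_inv hu]

theorem one_chartMul {u : E} (hu : u ∈ (φ).target) : chartMul E G (φ 1, u) = u := by
  simp only [chartMul, extChartAt_to_inv, one_mul, (φ).right_inv hu]

variable [LieGroup 𝓘(ℝ, E) ∞ G]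

theorem contDiffAt_chartMul {u v : E} (hu : u ∈ (φ).target) (hv : v ∈ (φ).target)
    (huv : (φ).symm u * (φ).symm v ∈ (φ).source) : ContDiffAt ℝ ∞ (chartMul E G) (u, v) := by
  have hsymm {w : E} (hw : w ∈ (φ).target) : ContMDiffAt 𝓘(ℝ, E) 𝓘(ℝ, E) ∞ (φ).symm w :=
    (contMDiffOn_extChartAt_symm 1).contMDiffAt ((isOpen_extChartAt_target 1).mem_nhds hw)
  have hmul := ((hsymm hu).comp (u, v) contDiffAt_fst.contMDiffAt).mul
    ((hsymm hv).comp (u, v) contDiffAt_snd.contMDiffAt)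
  exact ((contMDiffAt_extChartAt' (by simpa using huv)).comp (u, v) hmul).contDiffAt

theorem fderiv_chartMul_one_right {u : E} (hu : u ∈ (φ).target) (Z : E) :
    fderiv ℝ (chartMul E G) (u, φ 1) (0, Z) =
      modelMFDeriv ℝ E E (φ ∘ ((φ).symm u * ·)) (1 : G) Z := by
  have hx : (φ).symm u * 1 ∈ (chartAt E (1 : G)).source := by simpa using (φ).map_target hu
  have hmul : DifferentiableAt ℝ (chartMul E G) (u, φ 1) :=
    (contDiffAt_chartMul hu (mem_extChartAt_target 1) (by simpa using hx)).differentiableAt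
      (by simp)
  rw [← fderiv_prodMk_right hmul, modelMFDeriv_eq_fderiv
    ((mdifferentiableAt_extChartAt hx).comp 1 (mdifferentiableAt_mul_left _ 1))]
  rfl

theorem fderiv_chartMul_one_left {u : E} (hu : u ∈ (φ).target) (Z : E) :
    fderiv ℝ (chartMul E G) (φ 1, u) (Z, 0) =
      modelMFDeriv ℝ E E (φ ∘ (· * (φ).symm u)) (1 : G) Z := by
  have hx : 1 * (φ).symm u ∈ (chartAt E (1 : G)).source := by simpa using (φ).map_target hu
  have hmul : DifferentiableAt ℝ (chartMul E G) (φ 1, u) :=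
    (contDiffAt_chartMul (mem_extChartAt_target 1) hu (by simpa using hx)).differentiableAt
      (by simp)
  rw [← fderiv_prodMk_left hmul, modelMFDeriv_eq_fderiv
    ((mdifferentiableAt_extChartAt hx).comp 1 (mdifferentiableAt_mul_right _ 1))]
  rfl

/-- Read in the chart, this is the derivative at `y = 1` of `(x * y * x⁻¹) * x = x * y`. -/
theorem fderiv_chartMul_modelAd {u : E} (hu : u ∈ (φ).target) (Z : E) :
    fderiv ℝ (chartMul E G) (φ 1, u) (modelAd E ((φ).symm u) Z, 0) =
      fderiv ℝ (chartMul E G) (u, φ 1) (0, Z) := by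
  set x := (φ).symm u
  have hconj : (φ ∘ (x * ·) : G → E) = (φ ∘ (· * x)) ∘ fun y ↦ x * y * x⁻¹ := by
    ext y
    simp
  have hx : 1 * x ∈ (chartAt E (1 : G)).source := by simpa [x] using (φ).map_target hu
  rw [fderiv_chartMul_one_left hu, fderiv_chartMul_one_right hu, hconj,
    modelMFDeriv_comp (by simp)
      ((mdifferentiableAt_extChartAt hx).comp 1 (mdifferentiableAt_mul_right x 1))
      (mdifferentiableAt_conj x 1)]
  rfl

theorem mpullbackWithin_mulInvariantVectorField (Y : E) {u : E} (hu : u ∈ (φ).target) :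
    VectorField.mpullbackWithin 𝓘(ℝ, E) 𝓘(ℝ, E) (φ).symm
      (mulInvariantVectorField (I := 𝓘(ℝ, E)) (G := G) Y) (range 𝓘(ℝ, E)) u =
    fderiv ℝ (chartMul E G) (u, φ 1) (0, Y) := by
  have hx : (φ).symm u ∈ (chartAt E (1 : G)).source := by simpa using (φ).map_target hu
  rw [fderiv_chartMul_one_right hu, modelMFDeriv_comp (mul_one _)
    (mdifferentiableAt_extChartAt hx) (mdifferentiableAt_mul_left _ 1),
    VectorField.mpullbackWithin_apply, ContinuousLinearMap.inverse_eq
      (mfderivWithin_extChartAt_symm_comp_mfderiv_extChartAt hu)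
      (mfderiv_extChartAt_comp_mfderivWithin_extChartAt_symm hu)]
  rfl

theorem mlieBracket_mulInvariantVectorField_one (Y Z : E) :
    VectorField.mlieBracket 𝓘(ℝ, E) (mulInvariantVectorField (I := 𝓘(ℝ, E)) (G := G) Y)
      (mulInvariantVectorField (I := 𝓘(ℝ, E)) (G := G) Z) 1 =
    VectorField.lieBracket ℝ (fun u ↦ fderiv ℝ (chartMul E G) (u, φ 1) (0, Y))
      (fun u ↦ fderiv ℝ (chartMul E G) (u, φ 1) (0, Z)) (φ 1) := by
  have htarget : ∀ᶠ u in 𝓝 (φ 1), u ∈ (φ).target := extChartAt_target_mem_nhds 1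
  have hfield (Y : E) := htarget.mono fun u hu ↦
    mpullbackWithin_mulInvariantVectorField (G := G) Y hu
  have hwithin (v w : E → E) : VectorField.lieBracketWithin ℝ v w (range 𝓘(ℝ, E)) =
      VectorField.lieBracket ℝ v w := by
    rw [ModelWithCorners.range_eq_univ, VectorField.lieBracketWithin_univ]
  rw [VectorField.mlieBracket, VectorField.mlieBracketWithin_apply, mfderiv_extChartAt_self,
    preimage_univ, univ_inter]
  refine (DFunLike.congr_fun (ContinuousLinearMap.inverse_id (R := ℝ) (M := E)) _).trans ?_
  exact (congrFun (hwithin _ _) _).trans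
    (Filter.EventuallyEq.lieBracket_vectorField_eq (hfield Y) (hfield Z))

theorem adL_apply (Y Z : GroupLieAlgebra 𝓘(ℝ, E) G) : adL E G Y Z = ⁅Y, Z⁆ := by
  have htarget : ∀ᶠ u in 𝓝 (φ 1), u ∈ (φ).target := extChartAt_target_mem_nhds 1
  have hmul : ContDiffAt ℝ ∞ (chartMul E G) (φ 1, φ 1) :=
    contDiffAt_chartMul (mem_extChartAt_target 1) (mem_extChartAt_target 1) (by simp)
  have hAd : MDifferentiableAt 𝓘(ℝ, E) 𝓘(ℝ, E →L[ℝ] E) (modelAd E) (1 : G) :=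
    contMDiff_modelAd.mdifferentiableAt (by simp)
  have hchart : DifferentiableAt ℝ (modelAd E ∘ (φ).symm) (φ 1) :=
    ((contMDiff_modelAd _).comp (φ 1) ((contMDiffOn_extChartAt_symm 1).contMDiffAt
      (extChartAt_target_mem_nhds 1))).contDiffAt.differentiableAt (by simp)
  rw [adL, modelMFDeriv_eq_fderiv hAd, GroupLieAlgebra.bracket_def]
  refine .trans ?_ (mlieBracket_mulInvariantVectorField_one (E := E) (G := G) Y Z).symm
  exact fderiv_apply_eq_lieBracket (E := E) (hmul.of_le (by simp; norm_cast))
    (htarget.mono fun u ↦ chartMul_one) (htarget.mono fun u ↦ one_chartMul) hchart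
    (htarget.mono fun u hu ↦ fderiv_chartMul_modelAd hu) Y Z

end Adjoint

section FormGradient

variable {E F κ : Type*} [NormedAddCommGroup E] [NormedSpace ℝ E] [NormedAddCommGroup F]
  [NormedSpace ℝ F] [Fintype κ] {β : F →L[ℝ] E →L[ℝ] F} {τ : F →L[ℝ] ℝ}

/-- The vector `∑ₖ τ (β A vₖ) vₖ`, as a function of the pair `(A, v)`: a flow `A' = β A Y` increases
the linear form `τ` at rate `∑ₖ τ (β A vₖ) ^ 2` when `Y` is this vector. -/
noncomputable def formGradient (β : F →L[ℝ] E →L[ℝ] F) (τ : F →L[ℝ] ℝ) (p : F × (κ → E)) : E :=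
  ∑ k, τ (β p.1 (p.2 k)) • p.2 k

theorem apply_formGradient (A : F) (v : κ → E) :
    τ (β A (formGradient β τ (A, v))) = ∑ k, τ (β A (v k)) ^ 2 := by
  simp [formGradient, pow_two]

theorem sum_sq_eq_zero_iff {a : κ → ℝ} : ∑ k, a k ^ 2 = 0 ↔ ∀ k, a k = 0 := by
  simpa [pow_two] using Finset.sum_mul_self_eq_zero_iff Finset.univ a

theorem apply_eq_zero_of_tendsto_of_hasDerivAt_formGradient [ProperSpace F] {z : ℝ → κ → E}
    {T : ℝ} (hT : 0 < T) (hz : Continuous z) (hzT : Periodic z T) {A : ℝ → F}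
    (hAb : Bornology.IsBounded (range A))
    (hA : ∀ t, HasDerivAt A (β (A t) (formGradient β τ (A t, z t))) t)
    {ι : Type*} {l : Filter ι} [l.NeBot] {s : ι → ℝ} (hs : Tendsto s l atTop) {B : F}
    (hB : Tendsto (A ∘ s) l (𝓝 B)) (t : ℝ) (k : κ) : τ (β B (z t k)) = 0 := by
  let f (p : F × (κ → E)) : F := β p.1 (formGradient β τ p)
  let q (p : F × (κ → E)) : ℝ := ∑ k, τ (β p.1 (p.2 k)) ^ 2
  have hf : Continuous f := by simp only [f, formGradient]; fun_prop
  have hq : Continuous q := by simp only [q]; fun_prop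
  have hqf (p) (hp : q p = 0) : f p = 0 := by
    simp [f, formGradient, sum_sq_eq_zero_iff.1 hp]
  have hv (t : ℝ) : HasDerivAt (τ ∘ A) (q (A t, z t)) t := by
    simpa only [q, apply_formGradient] using τ.hasFDerivAt.comp_hasDerivAt t (hA t)
  have hvb : BddAbove (range (τ ∘ A)) := by
    rw [range_comp]
    exact (τ.lipschitz.isBounded_image hAb).bddAbove
  exact sum_sq_eq_zero_iff.1 (eq_zero_of_tendsto_of_periodic hf hq
    (fun p ↦ Finset.sum_nonneg fun k _ ↦ sq_nonneg _) hqf hT hz hzT hAb.isCompact_closure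
    (fun t ↦ subset_closure (mem_range_self t)) hA hv hvb hs hB t) k

end FormGradient

section LyapunovFunction

variable {E : Type*} [NormedAddCommGroup E] [NormedSpace ℝ E]
  {G : Type*} [TopologicalSpace G] [ChartedSpace E G] [Group G] {m : ℕ}
  {X : Fin m → GroupLieAlgebra 𝓘(ℝ, E) G} {xr : ℝ → G}

theorem dV_auxField (t : ℝ) (w : G) :
    dV w (auxField X xr t w) = ∑ k, auxCoeff X xr k t w ^ 2 := by
  simp only [auxField, map_sum, map_smul, smul_eq_mul, pow_two]
  rfl

theorem mem_criticalPoints_auxField_iff {w : G} :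
    w ∈ criticalPoints (auxField X xr) ↔ ∀ t k, auxCoeff X xr k t w = 0 := by
  refine ⟨fun hw t k ↦ ?_, fun hw t ↦ ?_⟩
  · have hsum : ∑ k, auxCoeff X xr k t w ^ 2 = 0 := by rw [← dV_auxField, hw t, map_zero]
    exact sum_sq_eq_zero_iff.1 hsum k
  · simp only [auxField, hw, zero_smul, Finset.sum_const_zero]

theorem forall_dV_mulInvariantVectorField_eq_zero_iff (hreg : IsRegular X xr) {w : G} :
    (∀ Y : GroupLieAlgebra 𝓘(ℝ, E) G, dV w (mulInvariantVectorField Y w) = 0) ↔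
      ∀ t k, auxCoeff X xr k t w = 0 := by
  refine ⟨fun h t k ↦ h _, fun h Y ↦ ?_⟩
  have hzero : (dV w ∘L mfderiv 𝓘(ℝ, E) 𝓘(ℝ, E) (w * ·) (1 : G) :
      GroupLieAlgebra 𝓘(ℝ, E) G →ₗ[ℝ] ℝ) = 0 :=
    LinearMap.ext_on hreg (by rintro _ ⟨t, k, rfl⟩; exact h t k)
  exact DFunLike.congr_fun hzero Y

variable [LieGroup 𝓘(ℝ, E) ∞ G]

theorem surjective_mulInvariantVectorField (w : G) :
    Surjective fun Y : GroupLieAlgebra 𝓘(ℝ, E) G ↦ mulInvariantVectorField Y w := by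
  intro ξ
  have hid : modelMFDeriv ℝ E E (id : G → G) w = .id ℝ E := mfderiv_id
  have hinv : ((w * ·) ∘ (w⁻¹ * ·) : G → G) = id := by ext; simp
  have h := modelMFDeriv_comp (inv_mul_cancel w) (mdifferentiableAt_mul_left (E := E) w 1)
    (mdifferentiableAt_mul_left w⁻¹ w)
  rw [hinv, hid] at h
  exact ⟨modelMFDeriv ℝ E E (w⁻¹ * ·) w ξ, (DFunLike.congr_fun h ξ).symm⟩

theorem dV_eq_zero_iff {w : G} : (dV w : TangentSpace 𝓘(ℝ, E) w →L[ℝ] ℝ) = 0 ↔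
    ∀ Y : GroupLieAlgebra 𝓘(ℝ, E) G, dV w (mulInvariantVectorField Y w) = 0 := by
  refine ⟨fun h Y ↦ by rw [h]; rfl, fun h ↦ ContinuousLinearMap.ext fun ξ ↦ ?_⟩
  obtain ⟨Y, rfl⟩ := surjective_mulInvariantVectorField w ξ
  exact h Y

variable [FiniteDimensional ℝ E]

variable (E) in
/-- The trace of endomorphisms as a continuous linear form. -/
noncomputable def traceCLM : (E →L[ℝ] E) →L[ℝ] ℝ :=
  LinearMap.toContinuousLinearMap (LinearMap.trace ℝ E ∘ₗ ContinuousLinearMap.coeLM ℝ)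

theorem dV_mulInvariantVectorField_eq_traceCLM (w : G) (Y : E) :
    dV w (mulInvariantVectorField (I := 𝓘(ℝ, E)) (G := G) Y w) =
      traceCLM E (compAd E G (modelAd E w) Y) := by
  rw [← modelMFDeriv_modelAd]
  have hAd : MDifferentiableAt 𝓘(ℝ, E) 𝓘(ℝ, E →L[ℝ] E) (modelAd E) w :=
    contMDiff_modelAd.mdifferentiableAt (by simp)
  exact DFunLike.congr_fun (modelMFDeriv_clm_comp (traceCLM E) hAd) _

theorem dV_mulInvariantVectorField (w : G) (Y : GroupLieAlgebra 𝓘(ℝ, E) G) :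
    dV w (mulInvariantVectorField Y w) = trAdad w Y := by
  have := FiniteDimensional.complete ℝ E
  refine (dV_mulInvariantVectorField_eq_traceCLM (E := E) w Y).trans ?_
  refine congrArg (LinearMap.trace ℝ E) (LinearMap.ext fun Z ↦ ?_)
  exact congrArg (modelAd E w) (adL_apply Y Z)

end LyapunovFunction

section OmegaLimit

theorem IsIntegralCurve.continuous {E : Type*} [NormedAddCommGroup E] [NormedSpace ℝ E]
    {M : Type*} [TopologicalSpace M] [ChartedSpace E M]
    {F : ℝ → (x : M) → TangentSpace 𝓘(ℝ, E) x} {γ : ℝ → M} (hγ : IsIntegralCurve F γ) :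
    Continuous γ :=
  continuous_iff_continuousAt.2 fun t ↦ (hγ t).continuousAt

theorem criticalPoints_subset_omegaLimitPoints {E : Type*} [NormedAddCommGroup E]
    [NormedSpace ℝ E] {M : Type*} [TopologicalSpace M] [ChartedSpace E M]
    (F : ℝ → (x : M) → TangentSpace 𝓘(ℝ, E) x) : criticalPoints F ⊆ omegaLimitPoints F := by
  intro w hw
  have hconst : IsIntegralCurve F fun _ ↦ w := fun t ↦ by
    have hzero : (1 : ℝ →L[ℝ] ℝ).smulRight (F t w) = 0 := by
      rw [hw t, ContinuousLinearMap.smulRight_zero]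
    rw [hzero]
    exact hasMFDerivAt_const w t
  exact mem_iUnion₂.2 ⟨0, w, fun _ ↦ w, hconst, rfl, (↑), Nat.strictMono_cast,
    tendsto_natCast_atTop_atTop, tendsto_const_nhds⟩

variable {E : Type*} [NormedAddCommGroup E] [NormedSpace ℝ E] [FiniteDimensional ℝ E]
  {G : Type*} [TopologicalSpace G] [ChartedSpace E G] [Group G] [LieGroup 𝓘(ℝ, E) ∞ G]
  {m : ℕ} {X : Fin m → GroupLieAlgebra 𝓘(ℝ, E) G} {xr : ℝ → G}

theorem auxField_eq_mulInvariantVectorField (t : ℝ) (w : G) :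
    auxField X xr t w = mulInvariantVectorField (I := 𝓘(ℝ, E)) (G := G)
      (formGradient (E := E) (compAd E G) (traceCLM E)
        (modelAd E w, fun k ↦ modelAd E (xr t) (X k : E))) w := by
  simp only [formGradient, ← dV_mulInvariantVectorField_eq_traceCLM (E := E)]
  exact (map_sum (modelMFDeriv ℝ E E (w * ·) (1 : G)) _ _ |>.trans
    (Finset.sum_congr rfl fun k _ ↦ map_smul (modelMFDeriv ℝ E E (w * ·) (1 : G)) _ _)).symm

theorem auxCoeff_eq_zero_of_mem_omegaLimitPoints
    (hAd : Bornology.IsBounded (range (modelAd E : G → E →L[ℝ] E))) {T : ℝ} (hT : 0 < T)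
    (hxr : Continuous xr) (hper : Periodic xr T) {w : G}
    (hw : w ∈ omegaLimitPoints (auxField X xr)) (t : ℝ) (k : Fin m) :
    auxCoeff X xr k t w = 0 := by
  obtain ⟨-, -, γ, hγ, -, s, -, hs, hsw⟩ := mem_iUnion₂.1 hw
  have hAdcont : Continuous (modelAd E : G → E →L[ℝ] E) := contMDiff_modelAd.continuous
  have hderiv (t : ℝ) := hasDerivAt_modelAd_comp hγ
    (auxField_eq_mulInvariantVectorField (X := X) (xr := xr) t (γ t))
  have hz : Continuous fun t k ↦ modelAd E (xr t) (X k : E) :=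
    continuous_pi fun k ↦ (hAdcont.comp hxr).clm_apply continuous_const
  exact (dV_mulInvariantVectorField_eq_traceCLM (E := E) w _).trans <|
    apply_eq_zero_of_tendsto_of_hasDerivAt_formGradient hT hz
      (hper.comp fun x k ↦ modelAd E x (X k : E))
      (hAd.subset (range_comp_subset_range γ _)) hderiv hs ((hAdcont.tendsto w).comp hsw) t k

end OmegaLimit

end LieTracking

open LieTracking Set Function in
theorem mainTheorem6_general
    {E : Type*} [NormedAddCommGroup E] [NormedSpace ℝ E] [FiniteDimensional ℝ E]
    {G : Type*} [TopologicalSpace G] [ChartedSpace E G] [Group G] [LieGroup 𝓘(ℝ, E) ∞ G]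
    (hAd : Bornology.IsBounded (range (modelAd E : G → E →L[ℝ] E)))
    {m : ℕ} {X : Fin m → GroupLieAlgebra 𝓘(ℝ, E) G} {T : ℝ} {xr : ℝ → G} (hT : 0 < T)
    (hxr : Continuous xr) (hper : Periodic xr T) (hreg : IsRegular X xr) :
    (∀ w ∈ omegaLimitPoints (auxField X xr),
      (∀ Y : GroupLieAlgebra 𝓘(ℝ, E) G, trAdad w Y = 0) ∧
      (∀ Y : GroupLieAlgebra 𝓘(ℝ, E) G,
        dV w (mulInvariantVectorField Y w) = 0)) ∧
    criticalPoints (auxField X xr) =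
      {w : G | ∀ Y : GroupLieAlgebra 𝓘(ℝ, E) G, trAdad w Y = 0} ∧
    criticalPoints (auxField X xr) =
      omegaLimitPoints (auxField X xr) ∧
    criticalPoints (auxField X xr) =
      {w : G | (dV w : TangentSpace 𝓘(ℝ, E) w →L[ℝ] ℝ) = 0} := by
  have hcrit (w : G) : w ∈ criticalPoints (auxField X xr) ↔
      ∀ Y : GroupLieAlgebra 𝓘(ℝ, E) G, dV w (mulInvariantVectorField Y w) = 0 :=
    mem_criticalPoints_auxField_iff.trans (forall_dV_mulInvariantVectorField_eq_zero_iff hreg).symm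
  have homega (w) (hw : w ∈ omegaLimitPoints (auxField X xr)) :
      ∀ Y : GroupLieAlgebra 𝓘(ℝ, E) G, dV w (mulInvariantVectorField Y w) = 0 :=
    (forall_dV_mulInvariantVectorField_eq_zero_iff hreg).2
      (auxCoeff_eq_zero_of_mem_omegaLimitPoints hAd hT hxr hper hw)
  refine ⟨fun w hw ↦ ⟨?_, homega w hw⟩, ?_, ?_, ?_⟩
  · simpa only [dV_mulInvariantVectorField] using homega w hw
  · ext w
    simp only [hcrit, dV_mulInvariantVectorField, mem_ofPred_eq]
  · exact (criticalPoints_subset_omegaLimitPoints _).antisymm fun w hw ↦ (hcrit w).2 (homega w hw)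
  · ext w
    rw [hcrit, mem_ofPred_eq, dV_eq_zero_iff]

theorem mainTheorem6
    {E : Type*} [NormedAddCommGroup E] [NormedSpace ℝ E] [FiniteDimensional ℝ E]
    {G : Type*} [TopologicalSpace G] [ChartedSpace E G] [Group G] [LieGroup 𝓘(ℝ, E) ∞ G]
    [T2Space G] [CompactSpace G] [ConnectedSpace G]
    {m : ℕ} (X : Fin m → GroupLieAlgebra 𝓘(ℝ, E) G)
    (T : ℝ) (xr : ℝ → G) (ur : Fin m → ℝ → ℝ)
    (hper : LieTracking.IsPeriodicTrajectory X T xr ur)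
    (hreg : LieTracking.IsRegular X xr) :
    (∀ w ∈ LieTracking.omegaLimitPoints (LieTracking.auxField X xr),
      (∀ Y : GroupLieAlgebra 𝓘(ℝ, E) G, LieTracking.trAdad w Y = 0) ∧
      (∀ Y : GroupLieAlgebra 𝓘(ℝ, E) G,
        LieTracking.dV w (mulInvariantVectorField Y w) = 0)) ∧
    LieTracking.criticalPoints (LieTracking.auxField X xr) =
      {w : G | ∀ Y : GroupLieAlgebra 𝓘(ℝ, E) G, LieTracking.trAdad w Y = 0} ∧
    LieTracking.criticalPoints (LieTracking.auxField X xr) =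
      LieTracking.omegaLimitPoints (LieTracking.auxField X xr) ∧
    LieTracking.criticalPoints (LieTracking.auxField X xr) =
      {w : G | (LieTracking.dV w : TangentSpace 𝓘(ℝ, E) w →L[ℝ] ℝ) = 0} :=
  have hAd : Continuous (LieTracking.modelAd E : G → E →L[ℝ] E) :=
    LieTracking.contMDiff_modelAd.continuous
  mainTheorem6_general (isCompact_range hAd).isBounded hper.period_pos
    hper.isIntegralCurve.continuous hper.periodic_curve hreg
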